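/- For a finite simple undirected graph $G$ with at least one vertex, let $A(G)$ be its adjacency matrix, $D(G)$ its diagonal degree matrix, and, for $\alpha\in[0,1]$, put $A_\alpha(G)=\alpha D(G)+(1-\alpha)A(G)$; let $\rho_\alpha(G)$ be the largest eigenvalue of $A_\alpha(G)$. A real number $\lambda$ is an $A_\alpha$-limit point if there is a sequence $(G_k)$ of such graphs with $\rho_\alpha(G_i)\neq\rho_\alpha(G_j)$ for $i\neq j$ and $\lim_{k\to\infty}\rho_\alpha(G_k)=\lambda$. Let $0\le\alpha<1-\frac{2\sqrt5}{5}=0.10557\ldots$. Then the equation $$3\alpha-\lambda-\frac{(1-\alpha)^2}{\alpha-\lambda}-2\theta'_\alpha(\lambda)=0,\qquad \theta'_\alpha(\lambda)=\frac{(2\alpha-\lambda)+\sqrt{(2\alpha-\lambda)^2-4(1-\alpha)^2}}{2},$$ has exactly one solution $\lambda>2$, denoted $\tau_0(\alpha)$, and every real number $\lambda\ge\tau_0(\alpha)$ is an $A_\alpha$-limit point. -/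

import Mathlib

open Filter Topology

/-- The matrix `A_α(G) = α D(G) + (1 - α) A(G)` of a finite simple graph `G`. -/
noncomputable def alphaMatrix {V : Type*} [Fintype V] [DecidableEq V] (α : ℝ)
    (G : SimpleGraph V) [DecidableRel G.Adj] : Matrix V V ℝ :=
  α • G.degMatrix ℝ + (1 - α) • G.adjMatrix ℝ

/-- The `A_α`-spectral radius of `G`: the largest eigenvalue of `A_α(G)`. The supremum is a
maximum whenever `G` has a vertex, see `isGreatest_alphaSpectralRadius`. -/
noncomputable def alphaSpectralRadius {V : Type*} [Fintype V] [DecidableEq V] (α : ℝ)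
    (G : SimpleGraph V) [DecidableRel G.Adj] : ℝ :=
  sSup {μ : ℝ | Module.End.HasEigenvalue (Matrix.toLin' (alphaMatrix α G)) μ}

theorem isGreatest_alphaSpectralRadius {V : Type*} [Fintype V] [DecidableEq V] [Nonempty V]
    (α : ℝ) (G : SimpleGraph V) [DecidableRel G.Adj] :
    IsGreatest {μ : ℝ | Module.End.HasEigenvalue (Matrix.toLin' (alphaMatrix α G)) μ}
      (alphaSpectralRadius α G) := by
  have hH : (alphaMatrix α G).IsHermitian := by
    have h : (alphaMatrix α G).transpose = alphaMatrix α G := by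
      simp [alphaMatrix, SimpleGraph.degMatrix]
    rw [Matrix.IsHermitian, Matrix.conjTranspose_eq_transpose_of_trivial, h]
  have hfin : {μ : ℝ |
      Module.End.HasEigenvalue (Matrix.toLin' (alphaMatrix α G)) μ}.Finite :=
    Module.End.finite_hasEigenvalue _
  refine hfin.isCompact.isGreatest_sSup ?_
  obtain ⟨v⟩ := ‹Nonempty V›
  refine ⟨hH.eigenvalues v, ?_⟩
  have hs := hH.eigenvalues_mem_spectrum_real v
  rw [← Matrix.spectrum_toLin'] at hs
  exact Module.End.hasEigenvalue_iff_mem_spectrum.2 hs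

open Classical in
/-- `x` is an `A_α`-limit point: the limit of the `A_α`-spectral radii of a sequence of finite
(nonempty, simple, undirected) graphs whose `A_α`-spectral radii are pairwise distinct. -/
def IsAlphaLimitPoint (α x : ℝ) : Prop :=
  ∃ (n : ℕ → ℕ) (G : ∀ k, SimpleGraph (Fin (n k + 1))),
    (∀ i j, i ≠ j → alphaSpectralRadius α (G i) ≠ alphaSpectralRadius α (G j)) ∧
    Tendsto (fun k => alphaSpectralRadius α (G k)) atTop (𝓝 x)

/-- `θ'_α`, the larger fixed point of `t ↦ 2α - x - (1 - α)² / t`. -/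
noncomputable def thetaPrime (α x : ℝ) : ℝ :=
  ((2 * α - x) + √((2 * α - x) ^ 2 - 4 * (1 - α) ^ 2)) / 2

/-- `F₀(x, α) = 3α - x - (1 - α)² / (α - x) - 2 θ'_α`. -/
noncomputable def F₀ (x α : ℝ) : ℝ :=
  3 * α - x - (1 - α) ^ 2 / (α - x) - 2 * thetaPrime α x

/-- `τ₀(α)`, the solution `x > 2` of `F₀(x, α) = 0` (it exists and is unique for every
`α ∈ [0, 1]`). -/
noncomputable def tau₀ (α : ℝ) : ℝ :=
  sInf {x : ℝ | 2 < x ∧ F₀ x α = 0}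

/-! ### Spectral radius bounds -/

section SpectralRadius

variable {V : Type*} [Fintype V] [DecidableEq V] {α : ℝ} {G : SimpleGraph V} [DecidableRel G.Adj]

/-! For each `t > τ₀`, caterpillars with spectral radius in `(t - ε, t]` are grown one spine vertex
at a time, together with a positive vector `y` that solves `A_α y = t y` except for a defect at the
root. Positivity gives `ρ ≤ t`; the Rayleigh quotient gives `ρ ≥ t - (q + α) a² / S`.

Put `b = 1 - α`. A new root with `n` leaves sends `q` to `m + M - mM/q - n c` and `a` to `a q / b`,
where `m + M = t - 2α`, `mM = b²`, `c = α + b²/(t - α)`. Since `θ' = -m`, the inequality `F₀ < 0`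
means exactly `c < M - m`. Choosing `n` greedily keeps `q` in `[m, m + c)`, below `M`. If the values
`a` stay bounded, `a² / S → 0` (`tendsto_sq_div_sum_sq`). Boundedness (`greedyProd_bounded`) comes
either from all factors `q / b` being at most 1, or from a nonincreasing energy; the bound on `α`
ensures that one of the two applies (`pendant_weight_le`). -/

theorem alphaMatrix_mulVec_apply (y : V → ℝ) (v : V) :
    (alphaMatrix α G).mulVec y v =
      ∑ w, if G.Adj v w then α * y v + (1 - α) * y w else 0 := by
  have h : ∀ w, (if G.Adj v w then α * y v + (1 - α) * y w else 0) =
      (if G.Adj v w then 1 else 0) * (α * y v) + (1 - α) * (if G.Adj v w then y w else 0) := by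
    intro w; split_ifs <;> ring
  rw [Finset.sum_congr rfl fun w _ => h w, Finset.sum_add_distrib, ← Finset.sum_mul,
    ← Finset.mul_sum]
  simp only [alphaMatrix, Matrix.add_mulVec, Matrix.smul_mulVec, Pi.add_apply, Pi.smul_apply,
    smul_eq_mul, SimpleGraph.adjMatrix_mulVec_apply, SimpleGraph.degMatrix,
    Matrix.mulVec_diagonal, SimpleGraph.neighborFinset_eq_filter, Finset.sum_filter]
  rw [← SimpleGraph.card_neighborFinset_eq_degree, SimpleGraph.neighborFinset_eq_filter,
    Finset.sum_boole]
  ring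

theorem alphaMatrix_isHermitian : (alphaMatrix α G).IsHermitian := by
  have h : (alphaMatrix α G).transpose = alphaMatrix α G := by
    simp [alphaMatrix, SimpleGraph.degMatrix]
  rw [Matrix.IsHermitian, Matrix.conjTranspose_eq_transpose_of_trivial, h]

theorem exists_mulVec_eq_alphaSpectralRadius_smul [Nonempty V] :
    ∃ z : V → ℝ, z ≠ 0 ∧ (alphaMatrix α G).mulVec z = alphaSpectralRadius α G • z := by
  obtain ⟨z, hz⟩ := (isGreatest_alphaSpectralRadius α G).1.exists_hasEigenvector
  exact ⟨z, hz.2, by simpa using hz.apply_eq_smul⟩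

theorem le_alphaSpectralRadius_of_mulVec_eq [Nonempty V] {μ : ℝ} {z : V → ℝ} (hz : z ≠ 0)
    (h : (alphaMatrix α G).mulVec z = μ • z) : μ ≤ alphaSpectralRadius α G := by
  refine (isGreatest_alphaSpectralRadius α G).2 ?_
  exact Module.End.hasEigenvalue_of_hasEigenvector (x := z)
    (Module.End.hasEigenvector_iff.2 ⟨Module.End.mem_eigenspace_iff.2 (by simpa using h), hz⟩)

/-- A positive supersolution bounds the spectral radius from above. -/
theorem alphaSpectralRadius_le_of_mulVec_le [Nonempty V] (hα₀ : 0 ≤ α) (hα₁ : α ≤ 1) {t : ℝ}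
    {y : V → ℝ} (hy : ∀ v, 0 < y v) (h : ∀ v, (alphaMatrix α G).mulVec y v ≤ t * y v) :
    alphaSpectralRadius α G ≤ t := by
  obtain ⟨z, hz0, hz⟩ := exists_mulVec_eq_alphaSpectralRadius_smul (α := α) (G := G)
  set ρ := alphaSpectralRadius α G
  -- Maximum principle: compare `z` with `B y` at the vertex where `|z| / y` peaks.
  obtain ⟨v, -, hv⟩ := Finset.exists_max_image Finset.univ (fun v => |z v| / y v)
    Finset.univ_nonempty
  set B := |z v| / y v with hB
  have hle : ∀ w, |z w| ≤ B * y w := fun w => (div_le_iff₀ (hy w)).1 (hv w (Finset.mem_univ w))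
  have hBv : B * y v = |z v| := div_mul_cancel₀ _ (hy v).ne'
  have hB0 : 0 ≤ B := by have := hy v; positivity
  have hBpos : 0 < B := by
    rcases hB0.eq_or_lt with h0 | h0
    · exact absurd (funext fun w => by
        have := hle w
        rw [← h0, zero_mul] at this
        exact abs_nonpos_iff.1 this) hz0
    · exact h0
  have key : ρ * |z v| ≤ B * (t * y v) := by
    calc ρ * |z v| ≤ |ρ * z v| := by
          rw [abs_mul]; exact mul_le_mul_of_nonneg_right (le_abs_self _) (abs_nonneg _)
      _ = |∑ w, if G.Adj v w then α * z v + (1 - α) * z w else 0| := by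
          rw [← alphaMatrix_mulVec_apply, hz]; simp
      _ ≤ ∑ w, |if G.Adj v w then α * z v + (1 - α) * z w else 0| :=
          Finset.abs_sum_le_sum_abs _ _
      _ ≤ ∑ w, B * (if G.Adj v w then α * y v + (1 - α) * y w else 0) := by
          refine Finset.sum_le_sum fun w _ => ?_
          split_ifs
          · refine (abs_add_le _ _).trans ?_
            rw [abs_mul, abs_mul, abs_of_nonneg hα₀, abs_of_nonneg (sub_nonneg.2 hα₁)]
            have h1 := mul_le_mul_of_nonneg_left (hle v) hα₀
            have h2 := mul_le_mul_of_nonneg_left (hle w) (sub_nonneg.2 hα₁)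
            linarith
          · simp
      _ = B * (alphaMatrix α G).mulVec y v := by
          rw [alphaMatrix_mulVec_apply, Finset.mul_sum]
      _ ≤ B * (t * y v) := mul_le_mul_of_nonneg_left (h v) hB0
  rw [← hBv, ← mul_assoc, mul_comm ρ B, mul_assoc] at key
  exact le_of_mul_le_mul_right (le_of_mul_le_mul_left key hBpos) (hy v)

/-- The Rayleigh quotient bounds the spectral radius from below. -/
theorem dotProduct_mulVec_le_alphaSpectralRadius [Nonempty V] (y : V → ℝ) :
    y ⬝ᵥ (alphaMatrix α G).mulVec y ≤ alphaSpectralRadius α G * (y ⬝ᵥ y) := by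
  set ρ := alphaSpectralRadius α G with hρ
  have hH : (ρ • (1 : Matrix V V ℝ) - alphaMatrix α G).IsHermitian := by
    refine Matrix.IsHermitian.sub ?_ alphaMatrix_isHermitian
    simp [Matrix.IsHermitian]
  have hpsd : (ρ • (1 : Matrix V V ℝ) - alphaMatrix α G).PosSemidef := by
    refine hH.posSemidef_iff_eigenvalues_nonneg.2 fun i => ?_
    have he := hH.mulVec_eigenvectorBasis i
    set z : V → ℝ := ⇑(hH.eigenvectorBasis i) with hz
    have hz0 : z ≠ 0 := by
      intro h0
      apply hH.eigenvectorBasis.toBasis.ne_zero i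
      ext j
      simpa using congrFun h0 j
    have h1 : (alphaMatrix α G).mulVec z = (ρ - hH.eigenvalues i) • z := by
      rw [Matrix.sub_mulVec, Matrix.smul_mulVec, Matrix.one_mulVec] at he
      rw [sub_smul, ← he, sub_sub_cancel]
    have := le_alphaSpectralRadius_of_mulVec_eq hz0 h1
    simp only [Pi.zero_apply]
    linarith
  have h := hpsd.dotProduct_mulVec_nonneg y
  rw [Matrix.sub_mulVec, Matrix.smul_mulVec, Matrix.one_mulVec, dotProduct_sub,
    dotProduct_smul, smul_eq_mul] at h
  simpa using h

theorem alphaSpectralRadius_le_of_iso {W : Type*} [Fintype W] [DecidableEq W] [Nonempty V]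
    [Nonempty W] {H : SimpleGraph W} [DecidableRel H.Adj] (e : G ≃g H) :
    alphaSpectralRadius α G ≤ alphaSpectralRadius α H := by
  obtain ⟨z, hz0, hz⟩ := exists_mulVec_eq_alphaSpectralRadius_smul (α := α) (G := G)
  refine le_alphaSpectralRadius_of_mulVec_eq (z := z ∘ e.symm) ?_ ?_
  · contrapose! hz0
    ext v
    simpa using congrFun hz0 (e v)
  · ext w
    have h := congrFun hz (e.symm w)
    rw [alphaMatrix_mulVec_apply] at h ⊢
    rw [← e.toEquiv.sum_comp]
    simp only [Pi.smul_apply, Function.comp_apply] at h ⊢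
    rw [← h]
    refine Finset.sum_congr rfl fun v _ => ?_
    have : H.Adj w (e v) ↔ G.Adj (e.symm w) v := by
      rw [← e.map_adj_iff, e.apply_symm_apply]
    simp [this]

theorem alphaSpectralRadius_eq_of_iso {W : Type*} [Fintype W] [DecidableEq W] [Nonempty V]
    [Nonempty W] {H : SimpleGraph W} [DecidableRel H.Adj] (e : G ≃g H) :
    alphaSpectralRadius α G = alphaSpectralRadius α H :=
  le_antisymm (alphaSpectralRadius_le_of_iso e) (alphaSpectralRadius_le_of_iso e.symm)

end SpectralRadius

/-! ### Caterpillars -/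

/-- There are a finite graph with a root and a positive vector `y` on its vertices with value `a`
at the root and squared norm at least `S`, such that `A_α y = t y` away from the root and
`(A_α y)(root) = (t - (q + α)) a`. -/
def HasRootedVector (α t q a S : ℝ) : Prop :=
  ∃ (V : Type) (_ : Fintype V) (_ : DecidableEq V) (G : SimpleGraph V) (_ : DecidableRel G.Adj)
    (r : V) (y : V → ℝ), (∀ v, 0 < y v) ∧ y r = a ∧ S ≤ y ⬝ᵥ y ∧
      ∀ v, (alphaMatrix α G).mulVec y v = t * y v - if v = r then (q + α) * a else 0

theorem HasRootedVector.single (α t : ℝ) : HasRootedVector α t (t - α) 1 1 := by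
  classical
  refine ⟨Unit, inferInstance, inferInstance, ⊥, inferInstance, (), fun _ => 1, ?_, rfl, ?_, ?_⟩
  · simp
  · simp [dotProduct]
  · intro v
    simp [alphaMatrix_mulVec_apply]

/-- The graph obtained from `G` by joining a new vertex to `r` and to `n` new leaves. -/
def attachStar {V : Type*} (G : SimpleGraph V) (r : V) (n : ℕ) :
    SimpleGraph (V ⊕ Option (Fin n)) where
  Adj
    | .inl v, .inl w => G.Adj v w
    | .inl v, .inr none => v = r
    | .inr none, .inl v => v = r
    | .inr none, .inr (some _) => True
    | .inr (some _), .inr none => True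
    | _, _ => False
  symm := ⟨by
    rintro (v | _ | i) (w | _ | j) h <;> first | exact h | exact SimpleGraph.Adj.symm h⟩
  loopless := ⟨by
    rintro (v | _ | i) h
    · exact G.loopless.irrefl v h
    · exact h
    · exact h⟩

section attachStar

variable {V : Type*} {G : SimpleGraph V} {r v w : V} {n : ℕ} {i j : Fin n}

@[simp] theorem attachStar_adj_inl_inl :
    (attachStar G r n).Adj (.inl v) (.inl w) ↔ G.Adj v w := Iff.rfl

@[simp] theorem attachStar_adj_inl_none :
    (attachStar G r n).Adj (.inl v) (.inr none) ↔ v = r := Iff.rfl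

@[simp] theorem attachStar_adj_none_inl :
    (attachStar G r n).Adj (.inr none) (.inl v) ↔ v = r := Iff.rfl

@[simp] theorem attachStar_adj_none_some :
    (attachStar G r n).Adj (.inr none) (.inr (some i)) := trivial

@[simp] theorem attachStar_adj_some_none :
    (attachStar G r n).Adj (.inr (some i)) (.inr none) := trivial

@[simp] theorem attachStar_not_adj_inl_some :
    ¬ (attachStar G r n).Adj (.inl v) (.inr (some i)) := id

@[simp] theorem attachStar_not_adj_some_inl :
    ¬ (attachStar G r n).Adj (.inr (some i)) (.inl v) := id

@[simp] theorem attachStar_not_adj_some_some :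
    ¬ (attachStar G r n).Adj (.inr (some i)) (.inr (some j)) := id

end attachStar

/-- The new edge adds `α a + (1 - α) b` at the old root, and the value `b = a q / (1 - α)` makes
this cancel the defect `(q + α) a`. The summand `α` in the defect thus prepays the old root's
increase in degree. -/
theorem HasRootedVector.attach {α t q a S : ℝ} (h : HasRootedVector α t q a S) (hα : α < 1)
    (ht : α < t) (hq : 0 < q) (n : ℕ) :
    HasRootedVector α t
      (t - 2 * α - (1 - α) ^ 2 / q - n * (α + (1 - α) ^ 2 / (t - α)))
      (a * q / (1 - α)) (S + (a * q / (1 - α)) ^ 2) := by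
  classical
  obtain ⟨V, _, _, G, _, r, y, hy, rfl, hS, hA⟩ := h
  have hβ : 0 < 1 - α := sub_pos.2 hα
  have htα : 0 < t - α := sub_pos.2 ht
  set b := y r * q / (1 - α) with hb
  have hb0 : 0 < b := by have := hy r; positivity
  -- Forced by the leaf equation `α l + (1 - α) b = t l`.
  set l := (1 - α) * b / (t - α) with hl
  have hl0 : 0 < l := by positivity
  let y' : V ⊕ Option (Fin n) → ℝ := Sum.elim y (fun o => o.elim b fun _ => l)
  refine ⟨V ⊕ Option (Fin n), inferInstance, inferInstance, attachStar G r n,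
    Classical.decRel _, .inr none, y', ?_, rfl, ?_, ?_⟩
  · rintro (v | _ | i)
    exacts [hy v, hb0, hl0]
  · have h0 : 0 ≤ ∑ _i : Fin n, l * l := by positivity
    simp only [dotProduct, Fintype.sum_sum_type, Fintype.sum_option, y', Sum.elim_inl,
      Sum.elim_inr, Option.elim] at hS ⊢
    nlinarith
  · rintro (v | _ | i)
    · have hv := hA v
      rw [alphaMatrix_mulVec_apply] at hv ⊢
      simp only [Fintype.sum_sum_type, Fintype.sum_option, y', Sum.elim_inl, Sum.elim_inr,
        Option.elim, attachStar_adj_inl_inl, attachStar_adj_inl_none,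
        attachStar_not_adj_inl_some, if_false, Finset.sum_const_zero, reduceCtorEq]
      have hbr : (1 - α) * b = y r * q := by rw [hb]; field_simp
      by_cases hvr : v = r
      · subst hvr
        rw [if_pos rfl] at hv ⊢
        linarith
      · rw [if_neg hvr] at hv ⊢
        linarith
    · rw [alphaMatrix_mulVec_apply]
      simp only [Fintype.sum_sum_type, Fintype.sum_option, y', Sum.elim_inl, Sum.elim_inr,
        Option.elim, attachStar_adj_none_inl, attachStar_adj_none_some, SimpleGraph.irrefl,
        if_false, if_true, Finset.sum_const, Finset.sum_ite_eq', Finset.mem_univ,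
        Finset.card_univ, Fintype.card_fin, nsmul_eq_mul]
      have h1 : (1 - α) * y r = (1 - α) ^ 2 / q * b := by rw [hb]; field_simp
      have h2 : (1 - α) * l = (1 - α) ^ 2 / (t - α) * b := by rw [hl]; ring
      rw [h1, h2]
      ring
    · rw [alphaMatrix_mulVec_apply]
      simp only [Fintype.sum_sum_type, Fintype.sum_option, y', Sum.elim_inl, Sum.elim_inr,
        Option.elim, attachStar_not_adj_some_inl, attachStar_adj_some_none,
        attachStar_not_adj_some_some, if_false, if_true, Finset.sum_const_zero, Sum.inr.injEq,
        reduceCtorEq]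
      have h2 : (t - α) * l = (1 - α) * b := by rw [hl]; field_simp
      linarith

open Classical in
theorem HasRootedVector.exists_graph {α t q a S : ℝ} (h : HasRootedVector α t q a S)
    (hα₀ : 0 ≤ α) (hα₁ : α ≤ 1) (hq : 0 < q) (hS : 0 < S) :
    ∃ (n : ℕ) (G : SimpleGraph (Fin (n + 1))),
      alphaSpectralRadius α G ≤ t ∧ t - (q + α) * a ^ 2 / S ≤ alphaSpectralRadius α G := by
  obtain ⟨V, _, _, G, _, r, y, hy, rfl, hSy, hA⟩ := h
  have : Nonempty V := ⟨r⟩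
  obtain ⟨n, hn⟩ := Nat.exists_eq_succ_of_ne_zero (Fintype.card_ne_zero (α := V))
  let e : V ≃ Fin (n + 1) := Fintype.equivFinOfCardEq hn
  have hiso := alphaSpectralRadius_eq_of_iso (α := α) (SimpleGraph.Iso.map e G)
  refine ⟨n, G.map e.toEmbedding, ?_, ?_⟩
  · refine le_trans (le_of_eq ?_) (alphaSpectralRadius_le_of_mulVec_le (G := G) hα₀ hα₁ hy
      (t := t) fun v => ?_)
    · rw [hiso]
      congr!
    · rw [hA v]
      have := hy r
      split_ifs <;> simp; positivity
  · refine le_trans ?_ (le_of_eq (a := alphaSpectralRadius α G) ?_)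
    · have h1 := dotProduct_mulVec_le_alphaSpectralRadius (α := α) (G := G) y
      have h2 : y ⬝ᵥ (alphaMatrix α G).mulVec y = t * (y ⬝ᵥ y) - (q + α) * y r ^ 2 := by
        simp only [dotProduct, hA, mul_sub, Finset.sum_sub_distrib, mul_ite, mul_zero,
          Finset.sum_ite_eq', Finset.mem_univ, if_true, Finset.mul_sum]
        congr 1
        · exact Finset.sum_congr rfl fun v _ => by ring
        · ring
      have hpos : 0 < y ⬝ᵥ y := hS.trans_le hSy
      have h3 : (q + α) * y r ^ 2 / (y ⬝ᵥ y) ≤ (q + α) * y r ^ 2 / S :=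
        div_le_div_of_nonneg_left (by positivity) hS hSy
      have h4 : t - (q + α) * y r ^ 2 / (y ⬝ᵥ y) ≤ alphaSpectralRadius α G := by
        rw [sub_le_iff_le_add, ← sub_le_iff_le_add', le_div_iff₀ hpos]
        linarith
      linarith
    · rw [hiso]
      congr!

/-! ### The greedy recursion -/

/-- One step of the greedy recursion: apply `q ↦ m + M - m M / q`, then subtract `c` as often as
the value stays at least `m`. -/
noncomputable def greedyStep (m M c q : ℝ) : ℝ :=
  m + M - m * M / q - ⌊(m + M - m * M / q - m) / c⌋₊ * c

section Greedy

variable {m M c q : ℝ}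

theorem le_greedyStep (hm : 0 < m) (hM : 0 < M) (hc : 0 < c) (hq : m ≤ q) :
    m ≤ greedyStep m M c q := by
  have h : m * M / q ≤ M := by
    rw [div_le_iff₀ (hm.trans_le hq)]; nlinarith
  have := Nat.floor_le (a := (m + M - m * M / q - m) / c) (div_nonneg (by linarith) hc.le)
  rw [le_div_iff₀ hc] at this
  unfold greedyStep
  linarith

theorem greedyStep_lt (hc : 0 < c) : greedyStep m M c q < m + c := by
  have := Nat.lt_floor_add_one ((m + M - m * M / q - m) / c)
  rw [div_lt_iff₀ hc] at this
  unfold greedyStep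
  linarith

/-- The fractional linear map with fixed points `m`, `M` conserves this energy. The subtraction
lowers `(g - m)(M - g)`, a parabola symmetric about `(m + M) / 2`, once the midpoint of the jump is
at most the axis. -/
theorem greedyStep_energy_le (hm : 0 < m) (hc : 0 < c) (hcm : c ≤ m) (hcM : c < M - m)
    (hq : m ≤ q) (hq' : q < m + c) :
    q ^ 2 * ((greedyStep m M c q - m) * (M - greedyStep m M c q)) ≤
      m * M * ((q - m) * (M - q)) := by
  have hq0 : 0 < q := hm.trans_le hq
  have hM : 0 < M := by linarith
  set g := m + M - m * M / q with hg
  have hcons : q ^ 2 * ((g - m) * (M - g)) = m * M * ((q - m) * (M - q)) := by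
    rw [hg]; field_simp; ring
  rw [← hcons]
  refine mul_le_mul_of_nonneg_left ?_ (sq_nonneg q)
  have hstep : greedyStep m M c q = g - ⌊(g - m) / c⌋₊ * c := rfl
  rw [hstep]
  rcases Nat.eq_zero_or_pos ⌊(g - m) / c⌋₊ with h0 | h0
  · simp [h0]
  · have h1 : (1 : ℝ) ≤ (⌊(g - m) / c⌋₊ : ℝ) := by exact_mod_cast h0
    set n : ℝ := (⌊(g - m) / c⌋₊ : ℝ)
    have hgq : g * (m + c) ≤ (m + M) * (m + c) - m * M := by
      have : m * M / (m + c) ≤ m * M / q :=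
        div_le_div_of_nonneg_left (by positivity) hq0 hq'.le
      rw [div_le_iff₀ (by linarith)] at this
      rw [hg]; linarith
    have h2 : 2 * g - c ≤ m + M := by
      -- After `hgq` this reduces to `(c - m)(M - m - c) ≤ 0`.
      have : (2 * g - c) * (m + c) ≤ (m + M) * (m + c) := by nlinarith
      exact le_of_mul_le_mul_right this (by linarith)
    have h3 : 0 ≤ n * c * (m + M - (2 * g - n * c)) := by
      apply mul_nonneg (by positivity)
      nlinarith
    nlinarith

/-- The greedy orbit of `q₀`. -/
noncomputable def greedyOrbit (m M c q₀ : ℝ) (k : ℕ) : ℝ := (greedyStep m M c)^[k] q₀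

/-- The products `∏_{i < k} q_i / b` along the greedy orbit. -/
noncomputable def greedyProd (m M c b q₀ : ℝ) (k : ℕ) : ℝ :=
  ∏ i ∈ Finset.range k, greedyOrbit m M c q₀ i / b

variable {b q₀ : ℝ}

theorem greedyOrbit_succ (k : ℕ) :
    greedyOrbit m M c q₀ (k + 1) = greedyStep m M c (greedyOrbit m M c q₀ k) :=
  Function.iterate_succ_apply' _ _ _

theorem greedyProd_succ (k : ℕ) :
    greedyProd m M c b q₀ (k + 1) = greedyProd m M c b q₀ k * greedyOrbit m M c q₀ k / b := by
  rw [greedyProd, Finset.prod_range_succ, mul_div_assoc]; rfl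

theorem le_greedyOrbit (hm : 0 < m) (hM : 0 < M) (hc : 0 < c) (hq : m ≤ q₀) (k : ℕ) :
    m ≤ greedyOrbit m M c q₀ k := by
  induction k with
  | zero => exact hq
  | succ k ih => rw [greedyOrbit_succ]; exact le_greedyStep hm hM hc ih

theorem greedyOrbit_succ_lt (hc : 0 < c) (k : ℕ) : greedyOrbit m M c q₀ (k + 1) < m + c := by
  rw [greedyOrbit_succ]; exact greedyStep_lt hc

theorem greedyProd_pos (hm : 0 < m) (hM : 0 < M) (hc : 0 < c) (hb : 0 < b) (hq : m ≤ q₀) (k : ℕ) :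
    0 < greedyProd m M c b q₀ k :=
  Finset.prod_pos fun i _ => div_pos (hm.trans_le (le_greedyOrbit hm hM hc hq i)) hb

theorem greedyProd_bounded (hm : 0 < m) (hM : 0 < M) (hc : 0 < c) (hb : 0 < b)
    (hb2 : m * M = b ^ 2) (hcM : c < M - m) (h : c ≤ m ∨ m + c ≤ b) (hq : m ≤ q₀) :
    ∃ C, ∀ k, greedyProd m M c b q₀ (k + 1) ≤ C := by
  set x := greedyProd m M c b q₀ with hx
  set u := greedyOrbit m M c q₀ with hu
  have hxpos : ∀ k, 0 < x k := greedyProd_pos hm hM hc hb hq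
  have hum : ∀ k, m ≤ u k := le_greedyOrbit hm hM hc hq
  have huM : ∀ k, u (k + 1) < m + c := greedyOrbit_succ_lt hc
  have hxs : ∀ k, x (k + 1) * b = x k * u k := fun k => by
    rw [hx, greedyProd_succ]; field_simp; rfl
  have hdec : ∀ k, u k ≤ b → x (k + 1) ≤ x k := fun k hk => by
    refine le_of_mul_le_mul_right ?_ hb
    rw [hxs]
    exact mul_le_mul_of_nonneg_left hk (hxpos k).le
  rcases h with h | h
  -- The energy is followed from index 1 because `q₀` itself need not lie below `m + c`.
  · have hE : ∀ k, x (k + 1) ^ 2 * ((u (k + 1) - m) * (M - u (k + 1))) ≤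
        x 1 ^ 2 * ((u 1 - m) * (M - u 1)) := by
      intro k
      induction k with
      | zero => exact le_rfl
      | succ k ih =>
        refine le_trans ?_ ih
        have h1 := greedyStep_energy_le hm hc h hcM (hum (k + 1)) (huM k)
        rw [hu, ← greedyOrbit_succ, ← hu, hb2] at h1
        have h2 := mul_le_mul_of_nonneg_left h1 (sq_nonneg (x (k + 1)))
        have h3 := hxs (k + 1)
        refine le_of_mul_le_mul_right ?_ (pow_pos hb 2)
        calc _ = (x (k + 1 + 1) * b) ^ 2 *
              ((u (k + 1 + 1) - m) * (M - u (k + 1 + 1))) := by ring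
          _ = x (k + 1) ^ 2 * (u (k + 1) ^ 2 *
              ((u (k + 1 + 1) - m) * (M - u (k + 1 + 1)))) := by rw [h3]; ring
          _ ≤ _ := h2
          _ = _ := by ring
    set E := x 1 ^ 2 * ((u 1 - m) * (M - u 1)) with hEdef
    have hmb : m < b := by
      by_contra hcon
      push Not at hcon
      nlinarith
    -- Lower bound of `(q - m)(M - q)` for `b ≤ q < m + c`: the product can grow only there, and
    -- there the energy controls it.
    set w := (b - m) * (M - m - c) with hw
    have hw0 : 0 < w := mul_pos (by linarith) (by linarith)
    have hE0 : 0 ≤ E := mul_nonneg (sq_nonneg _)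
      (mul_nonneg (by linarith [hum 1]) (by linarith [huM 0]))
    set C := √(E / w) with hC
    have hlarge : ∀ k, b ≤ u (k + 1) → x (k + 1) ≤ C := by
      intro k hk
      refine Real.le_sqrt_of_sq_le ?_
      rw [le_div_iff₀ hw0]
      refine le_trans (mul_le_mul_of_nonneg_left ?_ (sq_nonneg _)) (hE k)
      have := huM k
      exact mul_le_mul (by linarith) (by linarith) (by linarith) (by linarith)
    refine ⟨max (x 1) (C * (m + c) / b), fun k => ?_⟩
    induction k with
    | zero => exact le_max_left _ _
    | succ k ih =>
      rcases le_total (u (k + 1)) b with hk | hk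
      · exact (hdec _ hk).trans ih
      · refine le_trans ?_ (le_max_right _ _)
        rw [le_div_iff₀ hb, hxs]
        exact mul_le_mul (hlarge k hk) (huM k).le (hm.le.trans (hum _)) (Real.sqrt_nonneg _)
  · refine ⟨x 1, fun k => ?_⟩
    induction k with
    | zero => exact le_rfl
    | succ k ih => exact (hdec _ ((huM k).le.trans h)).trans ih

end Greedy

/-- Either the squares are summable and the numerator vanishes, or the denominator diverges under a
bounded numerator. -/
theorem tendsto_sq_div_sum_sq {x : ℕ → ℝ} {C : ℝ} (h0 : 0 < x 0) (hx : ∀ k, 0 ≤ x k)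
    (hC : ∀ k, x k ≤ C) :
    Tendsto (fun k => x k ^ 2 / ∑ i ∈ Finset.range (k + 1), x i ^ 2) atTop (𝓝 0) := by
  have hS0 : ∀ k, x 0 ^ 2 ≤ ∑ i ∈ Finset.range (k + 1), x i ^ 2 := fun k =>
    Finset.single_le_sum (f := fun i => x i ^ 2) (fun i _ => sq_nonneg _) (by simp)
  by_cases hs : Summable fun i => x i ^ 2
  · have h1 : Tendsto (fun k => x k ^ 2 / x 0 ^ 2) atTop (𝓝 0) := by
      simpa using hs.tendsto_atTop_zero.div_const (x 0 ^ 2)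
    refine squeeze_zero (fun k => ?_) (fun k => ?_) h1
    · have := hS0 k; positivity
    · exact div_le_div_of_nonneg_left (sq_nonneg _) (by positivity) (hS0 k)
  · have h1 : Tendsto (fun k => ∑ i ∈ Finset.range (k + 1), x i ^ 2) atTop atTop :=
      ((not_summable_iff_tendsto_nat_atTop_of_nonneg fun i => sq_nonneg (x i)).1 hs).comp
        (tendsto_add_atTop_nat 1)
    refine squeeze_zero (fun k => ?_) (fun k => ?_) (h1.const_div_atTop (C ^ 2))
    · have := hS0 k; positivity
    · have := hS0 k
      have h2 : 0 < x 0 ^ 2 := by positivity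
      exact div_le_div_of_nonneg_right (pow_le_pow_left₀ (hx k) (hC k) 2) (by linarith)

theorem HasRootedVector.greedy {α t m M c : ℝ} (hα : α < 1) (ht : α < t) (hm : 0 < m)
    (hM : 0 < M) (hsum : m + M = t - 2 * α) (hprod : m * M = (1 - α) ^ 2)
    (hc : c = α + (1 - α) ^ 2 / (t - α)) (hc0 : 0 < c) (hq : m ≤ t - α) (k : ℕ) :
    HasRootedVector α t (greedyOrbit m M c (t - α) k) (greedyProd m M c (1 - α) (t - α) k)
      (∑ i ∈ Finset.range (k + 1), greedyProd m M c (1 - α) (t - α) i ^ 2) := by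
  induction k with
  | zero => simpa [greedyOrbit, greedyProd] using HasRootedVector.single α t
  | succ k ih =>
    have hpos := hm.trans_le (le_greedyOrbit hm hM hc0 hq k)
    rw [Finset.sum_range_succ, greedyOrbit_succ, greedyProd_succ, greedyStep]
    have := ih.attach hα ht hpos
      ⌊(m + M - m * M / greedyOrbit m M c (t - α) k - m) / c⌋₊
    rw [← hc, ← hsum, ← hprod] at this
    exact this

/-! ### The equation defining `τ₀` -/

/-- Exhibits `F₀` as pendant weight `c` minus the gap `M - m`. -/
theorem F₀_eq (x α : ℝ) :
    F₀ x α = (α + (1 - α) ^ 2 / (x - α)) - √((2 * α - x) ^ 2 - 4 * (1 - α) ^ 2) := by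
  have : (1 - α) ^ 2 / (α - x) = -((1 - α) ^ 2 / (x - α)) := by
    rw [← neg_sub x α, div_neg]
  rw [F₀, thetaPrime, this]
  ring

theorem F₀_strictAntiOn {α : ℝ} (hα : α < 1) : StrictAntiOn (fun x => F₀ x α) (Set.Ici 2) := by
  intro x hx y hy hxy
  simp only [Set.mem_Ici] at hx hy
  simp only [F₀_eq]
  have h1 : (1 - α) ^ 2 / (y - α) ≤ (1 - α) ^ 2 / (x - α) :=
    div_le_div_of_nonneg_left (sq_nonneg _) (by linarith) (by linarith)
  have h2 : √((2 * α - x) ^ 2 - 4 * (1 - α) ^ 2) < √((2 * α - y) ^ 2 - 4 * (1 - α) ^ 2) := by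
    apply Real.sqrt_lt_sqrt <;> nlinarith
  linarith

theorem exists_F₀_eq_zero {α : ℝ} (hα₀ : 0 ≤ α) (hα₁ : α < 1) : ∃ x, 2 < x ∧ F₀ x α = 0 := by
  have hcont : ContinuousOn (fun x => F₀ x α) (Set.Icc 2 6) := by
    simp only [F₀_eq]
    refine ContinuousOn.sub (ContinuousOn.add continuousOn_const
      (ContinuousOn.div continuousOn_const (by fun_prop) ?_)) (by fun_prop)
    intro x hx
    have := hx.1
    linarith
  have h2 : 0 < F₀ 2 α := by
    rw [F₀_eq, show (2 * α - 2) ^ 2 - 4 * (1 - α) ^ 2 = 0 by ring, Real.sqrt_zero, sub_zero]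
    have h : 0 < 2 - α := by linarith
    have : 0 < 1 - α := by linarith
    positivity
  have h6 : F₀ 6 α ≤ 0 := by
    rw [F₀_eq]
    have h : (1 - α) ^ 2 / (6 - α) ≤ 1 := by
      rw [div_le_one (by linarith)]; nlinarith
    have : 2 ≤ √((2 * α - 6) ^ 2 - 4 * (1 - α) ^ 2) := by
      apply Real.le_sqrt_of_sq_le; nlinarith
    linarith
  obtain ⟨x, hx, hx0⟩ := intermediate_value_Icc' (by norm_num) hcont ⟨h6, h2.le⟩
  refine ⟨x, lt_of_le_of_ne hx.1 ?_, hx0⟩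
  rintro rfl
  exact h2.ne' hx0

theorem setOf_F₀_eq_zero {α : ℝ} (hα₀ : 0 ≤ α) (hα₁ : α < 1) :
    {x : ℝ | 2 < x ∧ F₀ x α = 0} = {tau₀ α} := by
  obtain ⟨x, hx, hx0⟩ := exists_F₀_eq_zero hα₀ hα₁
  have h : {x : ℝ | 2 < x ∧ F₀ x α = 0} = {x} := by
    ext y
    refine ⟨fun ⟨hy, hy0⟩ => ?_, ?_⟩
    · exact (F₀_strictAntiOn hα₁).injOn hy.le hx.le (hy0.trans hx0.symm)
    · rintro rfl
      exact ⟨hx, hx0⟩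
  rw [tau₀, h, csInf_singleton]

/-! ### Density of the spectral radii above `τ₀` -/

/-- The alternatives meet at `M = 2(1 - α)`, `m = (1 - α) / 2`, where both read `c ≤ (1 - α) / 2`.
That amounts to `α² + 2α(1 - α) ≤ (1 - α)² / 4`, i.e. `4/5 ≤ (1 - α)²`. -/
theorem pendant_weight_le {α t m M c : ℝ} (hα₀ : 0 ≤ α) (hα₁ : 4 / 5 ≤ (1 - α) ^ 2)
    (hα₂ : α < 1) (htα : 0 < t - α) (hm : 0 < m) (hM : 0 < M) (hsum : m + M = t - 2 * α)
    (hprod : m * M = (1 - α) ^ 2) (hc : c = α + (1 - α) ^ 2 / (t - α)) :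
    c ≤ m ∨ m + c ≤ 1 - α := by
  have hβ : 0 < 1 - α := by linarith
  have hcmul : (c - α) * (t - α) = (1 - α) ^ 2 := by rw [hc]; field_simp; ring
  have htm : t - α = α + (m + M) := by linarith
  rcases le_total M (2 * (1 - α)) with h | h
  · left
    have h0 := mul_le_mul_of_nonneg_left h hm.le
    have h1 : (1 - α) / 2 ≤ m := by
      refine le_of_mul_le_mul_right ?_ hβ
      linarith
    have h2 : (c - α) * (t - α) ≤ (m - α) * (t - α) := by
      have h3 := mul_le_mul h1 h1 (by positivity) hm.le
      have h4 := mul_le_mul_of_nonneg_left h hα₀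
      rw [hcmul, htm]
      linarith
    linarith [le_of_mul_le_mul_right h2 htα]
  · right
    have h0 := mul_le_mul_of_nonneg_left h hm.le
    have h1 : m ≤ (1 - α) / 2 := by
      refine le_of_mul_le_mul_right ?_ hβ
      linarith
    have h3 : 5 / 2 * (1 - α) ≤ m + M := by
      refine le_of_mul_le_mul_right ?_ hM
      have := mul_nonneg (sub_nonneg.2 h) (show 0 ≤ M - (1 - α) / 2 by linarith)
      linarith
    have h5 : 0 ≤ (1 - α) / 2 - α := by nlinarith
    have h2 : (c - α) * (t - α) ≤ ((1 - α) / 2 - α) * (t - α) := by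
      have h4 := mul_le_mul_of_nonneg_left h3 h5
      rw [hcmul, htm]
      linarith
    linarith [le_of_mul_le_mul_right h2 htα]

open Classical in
theorem exists_alphaSpectralRadius_mem_Ioc {α t ε : ℝ} (hα₀ : 0 ≤ α)
    (hα₁ : 4 / 5 ≤ (1 - α) ^ 2) (hα₂ : α < 1) (ht : 2 < t) (hF : F₀ t α < 0) (hε : 0 < ε) :
    ∃ (n : ℕ) (G : SimpleGraph (Fin (n + 1))), alphaSpectralRadius α G ∈ Set.Ioc (t - ε) t := by
  have hβ : 0 < 1 - α := by linarith
  set D := √((2 * α - t) ^ 2 - 4 * (1 - α) ^ 2) with hD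
  have hD2 : D ^ 2 = (t - 2 * α) ^ 2 - 4 * (1 - α) ^ 2 := by
    rw [hD, Real.sq_sqrt (by nlinarith)]; ring
  set c := α + (1 - α) ^ 2 / (t - α) with hc
  have htα : 0 < t - α := by linarith
  have hc0 : 0 < c := by positivity
  have hcD : c < D := by rw [F₀_eq] at hF; linarith
  have hDlt : D < t - 2 * α := by
    apply lt_of_pow_lt_pow_left₀ 2 (by linarith)
    nlinarith [pow_pos hβ 2]
  obtain ⟨m, hmdef⟩ : ∃ m, m = (t - 2 * α - D) / 2 := ⟨_, rfl⟩
  obtain ⟨M, hMdef⟩ : ∃ M, M = (t - 2 * α + D) / 2 := ⟨_, rfl⟩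
  have hm : 0 < m := by linarith
  have hM : 0 < M := by linarith
  have hsum : m + M = t - 2 * α := by rw [hmdef, hMdef]; ring
  have hprod : m * M = (1 - α) ^ 2 := by rw [hmdef, hMdef]; linarith
  have hcM : c < M - m := by rw [hmdef, hMdef]; linarith
  have hq : m ≤ t - α := by linarith
  have hcond : c ≤ m ∨ m + c ≤ 1 - α :=
    pendant_weight_le hα₀ hα₁ hα₂ htα hm hM hsum hprod hc
  set x := greedyProd m M c (1 - α) (t - α) with hx
  set u := greedyOrbit m M c (t - α) with hu
  have hxpos : ∀ k, 0 < x k := greedyProd_pos hm hM hc0 hβ hq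
  obtain ⟨C, hC⟩ := greedyProd_bounded hm hM hc0 hβ hprod hcM hcond hq
  have hbd : ∀ k, x k ≤ max (x 0) C := fun k => by
    cases k with
    | zero => exact le_max_left _ _
    | succ k => exact (hC k).trans (le_max_right _ _)
  have hlim := (tendsto_sq_div_sum_sq (hxpos 0) (fun k => (hxpos k).le) hbd).const_mul (m + c + α)
  rw [mul_zero] at hlim
  -- The bound `u k < m + c` is available only for `k ≥ 1`.
  obtain ⟨k, hk, hk1⟩ := ((hlim.eventually_lt_const hε).and (eventually_ge_atTop 1)).exists
  obtain ⟨j, rfl⟩ := Nat.exists_eq_add_of_le' hk1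
  have hS : 0 < ∑ i ∈ Finset.range (j + 1 + 1), x i ^ 2 :=
    Finset.sum_pos (fun i _ => pow_pos (hxpos i) 2) (by simp)
  obtain ⟨n, G, h1, h2⟩ := (HasRootedVector.greedy hα₂ (by linarith) hm hM hsum hprod hc hc0 hq
    (j + 1)).exists_graph hα₀ hα₂.le (hm.trans_le (le_greedyOrbit hm hM hc0 hq _)) hS
  refine ⟨n, G, lt_of_lt_of_le ?_ h2, h1⟩
  have h3 : (u (j + 1) + α) * (x (j + 1) ^ 2 / ∑ i ∈ Finset.range (j + 1 + 1), x i ^ 2) ≤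
      (m + c + α) * (x (j + 1) ^ 2 / ∑ i ∈ Finset.range (j + 1 + 1), x i ^ 2) :=
    mul_le_mul_of_nonneg_right (by linarith [show u (j + 1) < m + c from greedyOrbit_succ_lt hc0 j])
      (by positivity)
  rw [mul_div_assoc]
  linarith

open Classical in
-- Approaching strictly from above allows a strictly decreasing sequence of radii, hence pairwise
-- distinct ones.
theorem isAlphaLimitPoint_of_forall_exists {α x : ℝ}
    (h : ∀ ε > 0, ∃ (n : ℕ) (G : SimpleGraph (Fin (n + 1))),
      alphaSpectralRadius α G ∈ Set.Ioo x (x + ε)) : IsAlphaLimitPoint α x := by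
  set T : Set ℝ := {y | x < y ∧ ∃ (n : ℕ) (G : SimpleGraph (Fin (n + 1))),
    alphaSpectralRadius α G = y} with hT
  have hglb : IsGLB T x := by
    refine ⟨fun y hy => hy.1.le, fun z hz => le_of_forall_pos_le_add fun ε hε => ?_⟩
    obtain ⟨n, G, h1, h2⟩ := h ε hε
    exact (hz ⟨h1, n, G, rfl⟩).trans h2.le
  have hne : T.Nonempty := by
    obtain ⟨n, G, h1, -⟩ := h 1 one_pos
    exact ⟨_, h1, n, G, rfl⟩
  obtain ⟨u, hu, -, hlim, hmem⟩ :=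
    hglb.exists_seq_strictAnti_tendsto_of_notMem (fun hx => lt_irrefl x hx.1) hne
  choose _ n G hG using hmem
  refine ⟨n, G, fun i j hij => ?_, ?_⟩
  · rw [hG, hG]
    exact hu.injective.ne hij
  · simpa only [hG] using hlim

theorem corollary5p2 (α : ℝ) (hα₀ : 0 ≤ α) (hα₁ : α < 1 - 2 * √5 / 5) :
    {x : ℝ | 2 < x ∧ F₀ x α = 0} = {tau₀ α} ∧
      ∀ x : ℝ, tau₀ α ≤ x → IsAlphaLimitPoint α x := by
  have h5 : √5 ^ 2 = 5 := Real.sq_sqrt (by norm_num)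
  have h50 : 0 < √5 := by positivity
  have hα : α < 1 := by linarith
  have hsq : 4 / 5 ≤ (1 - α) ^ 2 := by nlinarith
  have hset := setOf_F₀_eq_zero hα₀ hα
  refine ⟨hset, fun x hx => isAlphaLimitPoint_of_forall_exists fun ε hε => ?_⟩
  obtain ⟨hτ, hτ0⟩ : 2 < tau₀ α ∧ F₀ (tau₀ α) α = 0 := hset.symm.subset rfl
  -- Aiming at `x + ε / 2` with tolerance `ε / 2` keeps the radius strictly above `x`, and makes
  -- `F₀` strictly negative even when `x = τ₀`.
  have hF : F₀ (x + ε / 2) α < 0 := by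
    rw [← hτ0]
    exact F₀_strictAntiOn hα hτ.le (Set.mem_Ici.2 (by linarith)) (by linarith)
  obtain ⟨n, G, h1, h2⟩ := exists_alphaSpectralRadius_mem_Ioc hα₀ hsq hα (by linarith) hF
    (half_pos hε)
  exact ⟨n, G, by linarith, by linarith⟩
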